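/- **Corollary D.** Let $h=(h_1,h_2,h_3):\mathbb C\to\mathbb R^3$ be the Enneper surface, that is, the minimal map $$h_i(z)=\mathrm{Re}\int_0^z p_i(w)\,dw,\qquad p_1(w)=\tfrac12(1-w^2),\quad p_2(w)=\tfrac i2(1+w^2),\quad p_3(w)=w,$$ and for $r>0$ let $\overline{\mathbb D_r}=\{z\in\mathbb C:|z|\le r\}$. For a smooth map $g$ into $\mathbb R^3$ let $A(\overline{\mathbb D_r},g)=\int_{\overline{\mathbb D_r}}\sqrt{|g_x|^2|g_y|^2-\langle g_x,g_y\rangle^2}\,dx\,dy$ be its area. Then for every $r>1$ the restriction of $h$ to $\overline{\mathbb D_r}$ is unstable: there is a smooth (up to the boundary) vector field $X:\overline{\mathbb D_r}\to\mathbb R^3$, normal to $h$ (that is, $X(z)\perp h_x(z),h_y(z)$ for all $z\in\overline{\mathbb D_r}$) and vanishing on $\partial\mathbb D_r$, such that $t\mapsto A(\overline{\mathbb D_r},h+tX)$ is twice differentiable at $t=0$ with $$\frac{d^2}{dt^2}\Big|_{t=0}A(\overline{\mathbb D_r},h+tX)<0.$$ -/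

import Mathlib

open scoped ContDiff Topology

noncomputable section

namespace MinimalSurface

/-- The map `z ↦ Re ∫_0^z α` into `ℝⁿ` with Weierstrass-Enneper data `α_i = p_i(w) dw`.
The integral is taken along the segment from `0` to `z`, parametrized by `s ↦ s z`,
`s ∈ [0, 1]`. -/
def weierstrassMap {n : ℕ} (p : Fin n → ℂ → ℂ) (z : ℂ) : EuclideanSpace ℝ (Fin n) :=
  WithLp.toLp 2 fun i => (∫ s in (0 : ℝ)..1, p i ((s : ℂ) * z) * z).re

/-- The Weierstrass-Enneper data of the Enneper surface. -/
def enneperData : Fin 3 → ℂ → ℂ :=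
  ![fun z => (1 / 2) * (1 - z ^ 2), fun z => (Complex.I / 2) * (1 + z ^ 2), fun z => z]

/-- The minimal map `ℂ → ℝ³` defining the Enneper surface. -/
def enneper : ℂ → EuclideanSpace ℝ (Fin 3) := weierstrassMap enneperData

/-- The area (counted with multiplicity) of a map `g = g(x + iy)` over `K ⊆ ℂ`:
the integral over `K` of `√(|g_x|² |g_y|² - ⟨g_x, g_y⟩²) dx dy`. -/
def area {n : ℕ} (K : Set ℂ) (g : ℂ → EuclideanSpace ℝ (Fin n)) : ℝ :=
  ∫ z in K, Real.sqrt
    (‖fderiv ℝ g z 1‖ ^ 2 * ‖fderiv ℝ g z Complex.I‖ ^ 2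
      - (inner ℝ (fderiv ℝ g z 1) (fderiv ℝ g z Complex.I)) ^ 2)

/-- `X` is an admissible normal variation field along `h` over the compact region `K`: it is smooth
up to the boundary (the restriction of a smooth map on the plane), it is orthogonal to the surface
`h`, and it vanishes on the boundary of `K`. -/
structure IsNormalVariation {n : ℕ} (K : Set ℂ) (h X : ℂ → EuclideanSpace ℝ (Fin n)) : Prop where
  smooth : ContDiff ℝ ∞ X
  normal : ∀ z ∈ K, ∀ v : ℂ, inner ℝ (X z) (fderiv ℝ h z v) = 0
  boundary : ∀ z ∈ frontier K, X z = 0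

/-- The function `t ↦ A(K, h + t X)` is differentiable near `t = 0` and twice differentiable at
`t = 0`, and its second derivative at `0` is `q`. -/
def HasSecondVariation {n : ℕ} (K : Set ℂ) (h X : ℂ → EuclideanSpace ℝ (Fin n)) (q : ℝ) : Prop :=
  ∃ A' : ℝ → ℝ,
    (∀ᶠ t in 𝓝 (0 : ℝ), HasDerivAt (fun s : ℝ => area K (fun z => h z + s • X z)) (A' t) t) ∧
      HasDerivAt A' q 0

/-- The minimal map `h`, restricted to `K`, is unstable: some normal variation fixing the boundary
has negative second variation of area. -/
def IsUnstable {n : ℕ} (K : Set ℂ) (h : ℂ → EuclideanSpace ℝ (Fin n)) : Prop :=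
  ∃ X : ℂ → EuclideanSpace ℝ (Fin n), IsNormalVariation K h X ∧
    ∃ q : ℝ, HasSecondVariation K h X q ∧ q < 0

end MinimalSurface

end

noncomputable section

namespace MinimalSurface

open MeasureTheory Set Filter
open scoped ContDiff Topology

/-! With `s = |z|²`, Enneper's surface is conformal with factor `(1 + s)² / 4`, and its Gauss map
`ν` is stereographic projection. For `X = u ν` with `u = 0` on the boundary circle, the second
variation is `∫ (|∇u|² - 8 u² / (1 + s)²)`. Take `u = (r² - s) / (r² + s)`, the first Dirichlet
eigenfunction of the hemisphere pulled back by `z ↦ z / r`; then `Δu = -8 r² u / (r² + s)²`, and the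
second variation becomes `∫ 8 (r² / (r² + s)² - 1 / (1 + s)²) u²`. The weight changes sign, but its
integral over every smaller centred disc is negative, and `u²` decreases radially, so integration by
parts gives a negative value (`intervalIntegral_radial_index_neg`).
`hasSecondVariation_of_conformal` justifies the formula. -/

/-! ### Second variation of area. -/

theorem hasDerivAt_integral_of_continuousOn {K : Set ℂ} (hK : IsCompact K) {ε : ℝ}
    {F F' : ℂ → ℝ → ℝ}
    (hF : ∀ t ∈ Icc (-ε) ε, ContinuousOn (fun z => F z t) K)
    (hF' : ContinuousOn (fun p : ℂ × ℝ => F' p.1 p.2) (K ×ˢ Icc (-ε) ε))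
    (hd : ∀ z ∈ K, ∀ t ∈ Icc (-ε) ε, HasDerivAt (F z) (F' z t) t)
    {t : ℝ} (ht : t ∈ Ioo (-ε) ε) :
    HasDerivAt (fun s => ∫ z in K, F z s) (∫ z in K, F' z t) t := by
  obtain ⟨C, hC⟩ := (hK.prod isCompact_Icc).exists_bound_of_continuousOn hF'
  have hsub : Ioo (-ε) ε ⊆ Icc (-ε) ε := Ioo_subset_Icc_self
  have hnhds : Ioo (-ε) ε ∈ 𝓝 t := isOpen_Ioo.mem_nhds ht
  have hint : ∀ s ∈ Icc (-ε) ε, IntegrableOn (fun z => F z s) K := fun s hs =>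
    (hF s hs).integrableOn_compact hK
  have hF't : ContinuousOn (fun z => F' z t) K :=
    hF'.comp (continuousOn_id.prodMk continuousOn_const) fun z hz => ⟨hz, hsub ht⟩
  refine (hasDerivAt_integral_of_dominated_loc_of_deriv_le (F := fun s z => F z s)
    (F' := fun s z => F' z s) (bound := fun _ => C) hnhds ?_ (hint t (hsub ht))
    (hF't.integrableOn_compact hK).aestronglyMeasurable ?_ ?_ ?_).2
  · filter_upwards [hnhds] with s hs using (hint s (hsub hs)).aestronglyMeasurable
  · exact (ae_restrict_iff' hK.measurableSet).2 (ae_of_all _ fun z hz s hs =>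
      hC (z, s) ⟨hz, hsub hs⟩)
  · exact integrableOn_const hK.measure_lt_top.ne
  · exact (ae_restrict_iff' hK.measurableSet).2 (ae_of_all _ fun z hz s hs =>
      hd z hz s (hsub hs))

/-- Tube lemma; it keeps the radicand away from the singularity of the square root for all small
`t`, uniformly on `K`. -/
theorem exists_pos_on_prod_Icc {K : Set ℂ} (hK : IsCompact K) {D : ℂ × ℝ → ℝ}
    (hD : Continuous D) (h0 : ∀ z ∈ K, 0 < D (z, 0)) :
    ∃ ε > 0, ∀ z ∈ K, ∀ t ∈ Icc (-ε) ε, 0 < D (z, t) := by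
  have h1 : ∀ᶠ t in 𝓝 (0 : ℝ), ∀ z ∈ K, 0 < D (z, t) :=
    hK.eventually_forall_of_forall_eventually fun z hz =>
      (hD.comp continuous_swap).continuousAt.eventually (lt_mem_nhds (h0 z hz))
  obtain ⟨δ, hδ, h2⟩ := Metric.eventually_nhds_iff.1 h1
  refine ⟨δ / 2, half_pos hδ, fun z hz t ht => h2 ?_ z hz⟩
  rw [Real.dist_eq, sub_zero]
  exact (abs_le.2 ht).trans_lt (half_lt_self hδ)

/-- Two derivatives at `0` of `t ↦ ∫ √(D z t)` for a family `D z` of quartic polynomials in `t`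
with positive constant term and no linear term. -/
theorem hasDerivAt_integral_sqrt_quartic {K : Set ℂ} (hK : IsCompact K)
    {d₀ d₂ d₃ d₄ : ℂ → ℝ} (h₀ : Continuous d₀) (h₂ : Continuous d₂) (h₃ : Continuous d₃)
    (h₄ : Continuous d₄) (hpos : ∀ z ∈ K, 0 < d₀ z) :
    ∃ A' : ℝ → ℝ,
      (∀ᶠ t in 𝓝 (0 : ℝ), HasDerivAt (fun s : ℝ => ∫ z in K,
        √(d₀ z + d₂ z * s ^ 2 + d₃ z * s ^ 3 + d₄ z * s ^ 4)) (A' t) t) ∧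
      HasDerivAt A' (∫ z in K, d₂ z / √(d₀ z)) 0 := by
  set D : ℂ → ℝ → ℝ := fun z s => d₀ z + d₂ z * s ^ 2 + d₃ z * s ^ 3 + d₄ z * s ^ 4 with hDdef
  set D' : ℂ → ℝ → ℝ := fun z s => d₂ z * (2 * s) + d₃ z * (3 * s ^ 2) + d₄ z * (4 * s ^ 3)
    with hD'def
  set D'' : ℂ → ℝ → ℝ := fun z s => d₂ z * 2 + d₃ z * (6 * s) + d₄ z * (12 * s ^ 2) with hD''def
  have hDc : Continuous fun p : ℂ × ℝ => D p.1 p.2 := by fun_prop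
  have hD'c : Continuous fun p : ℂ × ℝ => D' p.1 p.2 := by fun_prop
  have hD''c : Continuous fun p : ℂ × ℝ => D'' p.1 p.2 := by fun_prop
  have hDd : ∀ z s, HasDerivAt (D z) (D' z s) s := fun z s => by
    have := ((((hasDerivAt_pow 2 s).const_mul (d₂ z)).const_add (d₀ z)).add
      ((hasDerivAt_pow 3 s).const_mul (d₃ z))).add ((hasDerivAt_pow 4 s).const_mul (d₄ z))
    refine HasDerivAt.congr_deriv (f := D z) this ?_
    simp [hD'def]
  have hD'd : ∀ z s, HasDerivAt (D' z) (D'' z s) s := fun z s => by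
    have := ((((hasDerivAt_id s).const_mul 2).const_mul (d₂ z)).add
      (((hasDerivAt_pow 2 s).const_mul 3).const_mul (d₃ z))).add
      (((hasDerivAt_pow 3 s).const_mul 4).const_mul (d₄ z))
    refine HasDerivAt.congr_deriv (f := D' z) this ?_
    simp [hD''def]; ring
  obtain ⟨ε, hε, hDpos⟩ := exists_pos_on_prod_Icc hK hDc fun z hz => by
    simpa [hDdef] using hpos z hz
  have hsq : ∀ z ∈ K, ∀ t ∈ Icc (-ε) ε, HasDerivAt (fun s => √(D z s))
      (D' z t / (2 * √(D z t))) t := fun z hz t ht =>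
    (hDd z t).sqrt (hDpos z hz t ht).ne'
  have hS : Continuous fun p : ℂ × ℝ => √(D p.1 p.2) := hDc.sqrt
  have hne : ∀ p ∈ K ×ˢ Icc (-ε) ε, 2 * √(D p.1 p.2) ≠ 0 := fun p hp =>
    mul_ne_zero two_ne_zero (Real.sqrt_pos.2 (hDpos p.1 hp.1 p.2 hp.2)).ne'
  have hF'c : ContinuousOn (fun p : ℂ × ℝ => D' p.1 p.2 / (2 * √(D p.1 p.2)))
      (K ×ˢ Icc (-ε) ε) :=
    hD'c.continuousOn.div (hS.const_mul 2).continuousOn hne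
  set F'' : ℂ → ℝ → ℝ := fun z t =>
    (D'' z t * (2 * √(D z t)) - D' z t * (2 * (D' z t / (2 * √(D z t))))) / (2 * √(D z t)) ^ 2
    with hF''def
  have hF''c : ContinuousOn (fun p : ℂ × ℝ => F'' p.1 p.2) (K ×ˢ Icc (-ε) ε) :=
    ((hD''c.mul (hS.const_mul 2)).continuousOn.sub
      (hD'c.continuousOn.mul (hF'c.const_mul 2))).div
      ((hS.const_mul 2).pow 2).continuousOn fun p hp => pow_ne_zero 2 (hne p hp)
  have hF'd : ∀ z ∈ K, ∀ t ∈ Icc (-ε) ε, HasDerivAt (fun s => D' z s / (2 * √(D z s)))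
      (F'' z t) t := fun z hz t ht =>
    (hD'd z t).div ((hsq z hz t ht).const_mul 2) (hne (z, t) ⟨hz, ht⟩)
  refine ⟨fun t => ∫ z in K, D' z t / (2 * √(D z t)), ?_, ?_⟩
  · filter_upwards [isOpen_Ioo.mem_nhds (show (0 : ℝ) ∈ Ioo (-ε) ε by simp [hε])] with t ht
    exact hasDerivAt_integral_of_continuousOn hK (F := fun z s => √(D z s))
      (fun s _ => (hS.comp (continuous_id.prodMk continuous_const)).continuousOn) hF'c hsq ht
  · have h := hasDerivAt_integral_of_continuousOn hK (F := fun z s => D' z s / (2 * √(D z s)))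
      (fun s hs => hF'c.comp (continuousOn_id.prodMk continuousOn_const) fun z hz => ⟨hz, hs⟩)
      hF''c hF'd (show (0 : ℝ) ∈ Ioo (-ε) ε by simp [hε])
    convert h using 1
    refine setIntegral_congr_fun hK.measurableSet fun z hz => ?_
    have h3 : √(d₀ z) ≠ 0 := (Real.sqrt_pos.2 (hpos z hz)).ne'
    -- Since `D' z 0 = 0`, only `D'' / (2 √D)` survives at `t = 0`.
    simp only [hF''def, hDdef, hD'def, hD''def]
    norm_num
    field_simp

/-- The second variation of area at a conformal immersion `h` for which the first variation of
the area integrand along `X` vanishes pointwise. -/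
theorem hasSecondVariation_of_conformal {n : ℕ} {K : Set ℂ} (hK : IsCompact K)
    {h X : ℂ → EuclideanSpace ℝ (Fin n)} (hh : ContDiff ℝ ∞ h) (hX : ContDiff ℝ ∞ X)
    {l m q : ℂ → ℝ} (hl : ∀ z, 0 < l z)
    (hx : ∀ z, ‖fderiv ℝ h z 1‖ ^ 2 = l z) (hy : ∀ z, ‖fderiv ℝ h z Complex.I‖ ^ 2 = l z)
    (hxy : ∀ z, inner ℝ (fderiv ℝ h z 1) (fderiv ℝ h z Complex.I) = 0)
    (hxx' : ∀ z, inner ℝ (fderiv ℝ h z 1) (fderiv ℝ X z 1) = m z)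
    (hyy' : ∀ z, inner ℝ (fderiv ℝ h z Complex.I) (fderiv ℝ X z Complex.I) = -m z)
    (hxy' : ∀ z, inner ℝ (fderiv ℝ h z 1) (fderiv ℝ X z Complex.I) = 0)
    (hyx' : ∀ z, inner ℝ (fderiv ℝ h z Complex.I) (fderiv ℝ X z 1) = 0)
    (hq : ∀ z, ‖fderiv ℝ X z 1‖ ^ 2 + ‖fderiv ℝ X z Complex.I‖ ^ 2 - 4 * m z ^ 2 / l z = q z) :
    HasSecondVariation K h X (∫ z in K, q z) := by
  have ch : ∀ v, Continuous fun z => fderiv ℝ h z v := fun v =>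
    (hh.continuous_fderiv (by simp)).clm_apply continuous_const
  have cX : ∀ v, Continuous fun z => fderiv ℝ X z v := fun v =>
    (hX.continuous_fderiv (by simp)).clm_apply continuous_const
  have cl : Continuous l := by
    rw [← funext hx]; exact (ch 1).norm.pow 2
  have cm : Continuous m := by
    rw [← funext hxx']; exact (ch 1).inner (cX 1)
  set N := fun z => ‖fderiv ℝ X z 1‖ ^ 2 with hN
  set N' := fun z => ‖fderiv ℝ X z Complex.I‖ ^ 2 with hN'
  set M := fun z => inner ℝ (fderiv ℝ X z 1) (fderiv ℝ X z Complex.I) with hM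
  have cN : Continuous N := (cX 1).norm.pow 2
  have cN' : Continuous N' := (cX _).norm.pow 2
  have cM : Continuous M := (cX 1).inner (cX _)
  -- Expansion of `(l + 2mt + Nt²)(l - 2mt + N't²) - (Mt²)²`; the opposite signs of `m` remove the
  -- linear term.
  obtain ⟨A', h1, h2⟩ := hasDerivAt_integral_sqrt_quartic hK (d₀ := fun z => l z ^ 2)
    (d₂ := fun z => l z * (N z + N' z) - 4 * m z ^ 2)
    (d₃ := fun z => 2 * m z * (N' z - N z))
    (d₄ := fun z => N z * N' z - M z ^ 2)
    (by fun_prop) (by fun_prop) (by fun_prop) (by fun_prop) fun z _ => pow_pos (hl z) 2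
  refine ⟨A', ?_, ?_⟩
  · convert h1 using 4 with t s
    unfold area
    congr 1; ext z
    have hd : ∀ v, fderiv ℝ (fun z => h z + s • X z) z v = fderiv ℝ h z v + s • fderiv ℝ X z v := by
      intro v
      have h3 := hh.differentiable (by simp) z
      have h4 := hX.differentiable (by simp) z
      rw [fderiv_fun_add h3 (h4.fun_const_smul s), fderiv_fun_const_smul h4]
      simp
    rw [hd, hd]
    congr 1
    rw [norm_add_sq_real, norm_add_sq_real]
    simp only [inner_add_left, inner_add_right, inner_smul_left, inner_smul_right, norm_smul,
      mul_pow, hx, hy, hxy, hxx', hyy', hxy', hN, hN', hM, Real.norm_eq_abs, sq_abs,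
      real_inner_comm (fderiv ℝ h z Complex.I) (fderiv ℝ X z 1), hyx']
    simp
    ring
  · convert h2 using 3 with z
    have := (hl z).ne'
    rw [Real.sqrt_sq (hl z).le, ← hq]
    field_simp
    ring

/-! ### Radial reduction and sign of the integral. -/

theorem setIntegral_closedBall_radial {r : ℝ} (hr : 0 ≤ r) (g : ℝ → ℝ) :
    ∫ z in Metric.closedBall (0 : ℂ) r, g ‖z‖ = 2 * Real.pi * ∫ x in (0 : ℝ)..r, x * g x := by
  have h1 : ∀ z : ℂ, (Metric.closedBall (0 : ℂ) r).indicator (fun z => g ‖z‖) z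
      = (Iic r).indicator g ‖z‖ := fun z => by
    by_cases h : ‖z‖ ≤ r <;> simp [indicator, h]
  rw [← integral_indicator Metric.isClosed_closedBall.measurableSet, funext h1,
    integral_fun_norm_addHaar volume ((Iic r).indicator g)]
  have h2 : ∀ y : ℝ, y ^ (Module.finrank ℝ ℂ - 1) • (Iic r).indicator g y
      = (Iic r).indicator (fun x => x * g x) y := fun y => by
    by_cases hy : y ∈ Iic r <;> simp [hy, Complex.finrank_real_complex]
  rw [funext h2, setIntegral_indicator measurableSet_Iic, Ioi_inter_Iic,
    ← intervalIntegral.integral_of_le hr, Complex.finrank_real_complex]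
  simp [Measure.real, Complex.volume_ball]
  ring

/-- The radial integrand of the second variation for the variation function
`u(s) = (r² - s) / (r² + s)`, `s = |z|²`, on the disc of radius `r > 1`. -/
theorem intervalIntegral_radial_index_neg {r : ℝ} (hr : 1 < r) :
    ∫ x in (0 : ℝ)..r, x * (16 * r ^ 4 * x ^ 2 / (r ^ 2 + x ^ 2) ^ 4
      - 8 * ((r ^ 2 - x ^ 2) / ((r ^ 2 + x ^ 2) * (1 + x ^ 2))) ^ 2) < 0 := by
  have hr0 : 0 < r := by linarith
  have p1 : ∀ x : ℝ, r ^ 2 + x ^ 2 ≠ 0 := fun x => by positivity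
  have p2 : ∀ x : ℝ, 1 + x ^ 2 ≠ 0 := fun x => by positivity
  -- As functions of `x = |z|`, `W = x u u' + Q u²`, where `Q = 4 / (1 + x²) - 4 r² / (r² + x²)` is
  -- the primitive, zero at `0`, of `8x (r² / (r² + x²)² - 1 / (1 + x²)²)`.
  set W : ℝ → ℝ := fun x => (-(4 * r ^ 2 * x ^ 2 * (r ^ 2 - x ^ 2))) / (r ^ 2 + x ^ 2) ^ 3
    + 4 * (r ^ 2 - x ^ 2) ^ 2 * x ^ 2 * (1 - r ^ 2) / ((r ^ 2 + x ^ 2) ^ 3 * (1 + x ^ 2)) with hW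
  -- This is `2 u u' Q`, positive on `(0, r)` because `u' < 0` and `Q < 0`.
  set P : ℝ → ℝ := fun x => 32 * r ^ 2 * (r ^ 2 - x ^ 2) * x ^ 3 * (r ^ 2 - 1)
    / ((r ^ 2 + x ^ 2) ^ 4 * (1 + x ^ 2)) with hP
  set g : ℝ → ℝ := fun x => x * (16 * r ^ 4 * x ^ 2 / (r ^ 2 + x ^ 2) ^ 4
      - 8 * ((r ^ 2 - x ^ 2) / ((r ^ 2 + x ^ 2) * (1 + x ^ 2))) ^ 2) with hg
  have hPc : Continuous P := by
    refine Continuous.div (by fun_prop) (by fun_prop) fun x => ?_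
    exact mul_ne_zero (pow_ne_zero _ (p1 x)) (p2 x)
  have hgc : Continuous g := by
    refine continuous_id.mul (Continuous.sub (Continuous.div (by fun_prop) (by fun_prop) ?_)
      (continuous_const.mul ((Continuous.div (by fun_prop) (by fun_prop) ?_).pow 2)))
    · exact fun x => pow_ne_zero _ (p1 x)
    · exact fun x => mul_ne_zero (p1 x) (p2 x)
  have hWd : ∀ x, HasDerivAt W (g x + P x) x := fun x => by
    have e : HasDerivAt (fun x : ℝ => x ^ 2) (2 * x) x := by simpa using hasDerivAt_pow 2 x
    have a := (e.const_sub (r ^ 2))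
    have b := (e.const_add (r ^ 2))
    have c := (e.const_add 1)
    have := ((((e.const_mul (4 * r ^ 2)).mul a).neg).div (b.pow 3) (pow_ne_zero _ (p1 x))).add
      (((((a.pow 2).const_mul 4).mul e).mul_const (1 - r ^ 2)).div ((b.pow 3).mul c)
        (mul_ne_zero (pow_ne_zero _ (p1 x)) (p2 x)))
    refine HasDerivAt.congr_deriv (f := W) this ?_
    have := p1 x
    have := p2 x
    simp only [hg, hP, Pi.pow_apply, Pi.mul_apply, Pi.neg_apply]
    field_simp
    ring
  have h1 : ∫ x in (0 : ℝ)..r, (g x + P x) = 0 := by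
    rw [intervalIntegral.integral_eq_sub_of_hasDerivAt (fun x _ => hWd x)
      ((hgc.add hPc).intervalIntegrable _ _)]
    simp [hW]
  rw [intervalIntegral.integral_add (hgc.intervalIntegrable _ _)
    (hPc.intervalIntegrable _ _)] at h1
  have h2 : 0 < ∫ x in (0 : ℝ)..r, P x := by
    refine intervalIntegral.intervalIntegral_pos_of_pos_on (hPc.intervalIntegrable _ _) ?_ hr0
    rintro x ⟨hx0, hxr⟩
    have h3 : 0 < r ^ 2 - x ^ 2 := by nlinarith
    have h4 : 0 < r ^ 2 - 1 := by nlinarith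
    simp only [hP]
    positivity
  linarith

/-! ### Enneper's surface in real coordinates. -/

theorem weierstrassMap_apply {n : ℕ} {p P : Fin n → ℂ → ℂ} (hp : ∀ i, Continuous (p i))
    (hP : ∀ i w, HasDerivAt (P i) (p i w) w) (hP0 : ∀ i, P i 0 = 0) (z : ℂ) (i : Fin n) :
    weierstrassMap p z i = (P i z).re := by
  have hd : ∀ s : ℝ, HasDerivAt (fun s : ℝ => P i (s * z)) (p i (s * z) * z) s := fun s => by
    have h1 : HasDerivAt (fun s : ℝ => (s : ℂ) * z) z s := by
      simpa using (Complex.ofRealCLM.hasDerivAt (x := s)).mul_const z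
    exact (hP i (s * z)).comp s h1
  have hc : Continuous fun s : ℝ => p i (s * z) * z :=
    ((hp i).comp (Complex.continuous_ofReal.mul continuous_const)).mul continuous_const
  simp only [weierstrassMap]
  rw [intervalIntegral.integral_eq_sub_of_hasDerivAt (fun s _ => hd s)
    (hc.intervalIntegrable _ _)]
  simp [hP0]

theorem enneper_eq (z : ℂ) : enneper z = !₂[
    (z.re - z.re ^ 3 / 3 + z.re * z.im ^ 2) / 2,
    -(z.im + z.re ^ 2 * z.im - z.im ^ 3 / 3) / 2,
    (z.re ^ 2 - z.im ^ 2) / 2] := by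
  ext i
  rw [enneper, weierstrassMap_apply (P := ![fun z => (1 / 2) * (z - z ^ 3 / 3),
    fun z => (Complex.I / 2) * (z + z ^ 3 / 3), fun z => z ^ 2 / 2])]
  · fin_cases i <;> simp [pow_succ, Complex.normSq] <;> ring
  · intro i
    fin_cases i <;> simp [enneperData] <;> fun_prop
  · intro i w
    fin_cases i <;> simp [enneperData]
    · exact HasDerivAt.congr_deriv (((hasDerivAt_id w).sub
        ((hasDerivAt_pow 3 w).div_const 3)).const_mul (2⁻¹ : ℂ)) (by simp)
    · exact HasDerivAt.congr_deriv (((hasDerivAt_id w).add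
        ((hasDerivAt_pow 3 w).div_const 3)).const_mul (Complex.I / 2)) (by simp)
    · exact HasDerivAt.congr_deriv ((hasDerivAt_pow 2 w).div_const 2) (by simp)
  · intro i
    fin_cases i <;> simp

theorem contDiff_enneper : ContDiff ℝ ∞ enneper := by
  have hre : ContDiff ℝ ∞ Complex.re := Complex.reCLM.contDiff
  have him : ContDiff ℝ ∞ Complex.im := Complex.imCLM.contDiff
  rw [funext enneper_eq, contDiff_euclidean]
  intro i
  fin_cases i <;> simp <;> fun_prop

theorem fderiv_enneper (z v : ℂ) : fderiv ℝ enneper z v = !₂[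
    (1 - z.re ^ 2 + z.im ^ 2) / 2 * v.re + z.re * z.im * v.im,
    -(z.re * z.im) * v.re - (1 + z.re ^ 2 - z.im ^ 2) / 2 * v.im,
    z.re * v.re - z.im * v.im] := by
  have hx : HasFDerivAt Complex.re Complex.reCLM z := Complex.reCLM.hasFDerivAt
  have hy : HasFDerivAt Complex.im Complex.imCLM z := Complex.imCLM.hasFDerivAt
  have hd := (contDiff_enneper.differentiable (by simp) z).hasFDerivAt
  ext i
  -- Uniqueness of the derivative reduces the claim to differentiating one real polynomial per
  -- coordinate.
  have key : ∀ L : ℂ →L[ℝ] ℝ, HasFDerivAt (fun z => enneper z i) L z →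
      fderiv ℝ enneper z v i = L v := fun L hL => by
    rw [← (((EuclideanSpace.proj i).hasFDerivAt (𝕜 := ℝ)).comp z hd).unique hL]; rfl
  simp only [enneper_eq] at key
  fin_cases i
  · refine (key _ (((hx.sub ((hx.pow 3).mul_const 3⁻¹)).add
      (hx.mul (hy.pow 2))).mul_const 2⁻¹)).trans ?_
    simp; ring
  · refine (key _ (((hy.add ((hx.pow 2).mul hy)).sub
      ((hy.pow 3).mul_const 3⁻¹)).neg.mul_const 2⁻¹)).trans ?_
    simp; ring
  · refine (key _ (((hx.pow 2).sub (hy.pow 2)).mul_const 2⁻¹)).trans ?_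
    simp; ring

/-! ### The normal variation field and its second variation. -/

/-- The normal `(2x, 2y, |z|² - 1)` of the Enneper surface, of length `1 + |z|²`. -/
def enneperNormal (z : ℂ) : EuclideanSpace ℝ (Fin 3) :=
  !₂[2 * z.re, 2 * z.im, z.re ^ 2 + z.im ^ 2 - 1]

theorem contDiff_enneperNormal : ContDiff ℝ ∞ enneperNormal := by
  have hre : ContDiff ℝ ∞ Complex.re := Complex.reCLM.contDiff
  have him : ContDiff ℝ ∞ Complex.im := Complex.imCLM.contDiff
  rw [contDiff_euclidean]
  intro i
  fin_cases i <;> simp [enneperNormal] <;> fun_prop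

theorem fderiv_enneperNormal (z v : ℂ) : fderiv ℝ enneperNormal z v =
    !₂[2 * v.re, 2 * v.im, 2 * z.re * v.re + 2 * z.im * v.im] := by
  have hx : HasFDerivAt Complex.re Complex.reCLM z := Complex.reCLM.hasFDerivAt
  have hy : HasFDerivAt Complex.im Complex.imCLM z := Complex.imCLM.hasFDerivAt
  have hd := (contDiff_enneperNormal.differentiable (by simp) z).hasFDerivAt
  ext i
  have key : ∀ L : ℂ →L[ℝ] ℝ, HasFDerivAt (fun z => enneperNormal z i) L z →
      fderiv ℝ enneperNormal z v i = L v := fun L hL => by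
    rw [← (((EuclideanSpace.proj i).hasFDerivAt (𝕜 := ℝ)).comp z hd).unique hL]; rfl
  simp only [enneperNormal] at key
  fin_cases i
  · refine (key _ (hx.const_mul 2)).trans ?_
    simp
  · refine (key _ (hy.const_mul 2)).trans ?_
    simp
  · refine (key _ (((hx.pow 2).add (hy.pow 2)).sub_const 1)).trans ?_
    simp

/-- The coefficient `(r² - |z|²) / ((r² + |z|²) (1 + |z|²))` of `enneperNormal` in the
destabilizing variation field. -/
def variationCoeff (r : ℝ) (z : ℂ) : ℝ :=
  (r ^ 2 - (z.re ^ 2 + z.im ^ 2)) /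
    ((r ^ 2 + (z.re ^ 2 + z.im ^ 2)) * (1 + (z.re ^ 2 + z.im ^ 2)))

/-- The derivative of `(r² - s) / ((r² + s) (1 + s))` with respect to `s`, at `s = |z|²`. -/
def variationCoeffDeriv (r : ℝ) (z : ℂ) : ℝ :=
  (-((r ^ 2 + (z.re ^ 2 + z.im ^ 2)) * (1 + (z.re ^ 2 + z.im ^ 2)))
      - (r ^ 2 - (z.re ^ 2 + z.im ^ 2)) * (1 + r ^ 2 + 2 * (z.re ^ 2 + z.im ^ 2))) /
    ((r ^ 2 + (z.re ^ 2 + z.im ^ 2)) * (1 + (z.re ^ 2 + z.im ^ 2))) ^ 2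

theorem variationCoeff_denom_ne_zero {r : ℝ} (hr : 0 < r) (z : ℂ) :
    (r ^ 2 + (z.re ^ 2 + z.im ^ 2)) * (1 + (z.re ^ 2 + z.im ^ 2)) ≠ 0 := by
  positivity

theorem contDiff_variationCoeff {r : ℝ} (hr : 0 < r) : ContDiff ℝ ∞ (variationCoeff r) := by
  have hre : ContDiff ℝ ∞ Complex.re := Complex.reCLM.contDiff
  have him : ContDiff ℝ ∞ Complex.im := Complex.imCLM.contDiff
  exact ContDiff.div (by fun_prop) (by fun_prop) (variationCoeff_denom_ne_zero hr)

theorem fderiv_variationCoeff {r : ℝ} (hr : 0 < r) (z v : ℂ) :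
    fderiv ℝ (variationCoeff r) z v =
      variationCoeffDeriv r z * (2 * z.re * v.re + 2 * z.im * v.im) := by
  have hx : HasFDerivAt Complex.re Complex.reCLM z := Complex.reCLM.hasFDerivAt
  have hy : HasFDerivAt Complex.im Complex.imCLM z := Complex.imCLM.hasFDerivAt
  have hs := (hx.pow 2).add (hy.pow 2)
  have hf : HasDerivAt (fun s : ℝ => (r ^ 2 - s) / ((r ^ 2 + s) * (1 + s)))
      (variationCoeffDeriv r z) (z.re ^ 2 + z.im ^ 2) := by
    have h := hasDerivAt_id (z.re ^ 2 + z.im ^ 2)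
    refine HasDerivAt.congr_deriv ((h.const_sub (r ^ 2)).div
      ((h.const_add (r ^ 2)).mul (h.const_add 1)) (variationCoeff_denom_ne_zero hr z)) ?_
    simp [variationCoeffDeriv]
    ring
  have h := hf.comp_hasFDerivAt z hs
  rw [show variationCoeff r = (fun s : ℝ => (r ^ 2 - s) / ((r ^ 2 + s) * (1 + s))) ∘
    ((fun z : ℂ => z.re ^ 2) + fun z : ℂ => z.im ^ 2) from rfl, h.fderiv]
  simp
  ring

/-- The destabilizing normal variation field of the Enneper surface over the disc of radius `r`. -/
def enneperVariation (r : ℝ) (z : ℂ) : EuclideanSpace ℝ (Fin 3) :=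
  variationCoeff r z • enneperNormal z

theorem contDiff_enneperVariation {r : ℝ} (hr : 0 < r) : ContDiff ℝ ∞ (enneperVariation r) :=
  (contDiff_variationCoeff hr).smul contDiff_enneperNormal

theorem fderiv_enneperVariation {r : ℝ} (hr : 0 < r) (z v : ℂ) :
    fderiv ℝ (enneperVariation r) z v = variationCoeff r z • fderiv ℝ enneperNormal z v +
      (variationCoeffDeriv r z * (2 * z.re * v.re + 2 * z.im * v.im)) • enneperNormal z := by
  have h1 := (contDiff_variationCoeff hr).differentiable (by simp) z
  have h2 := contDiff_enneperNormal.differentiable (by simp) z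
  rw [← fderiv_variationCoeff hr, show enneperVariation r =
    fun z => variationCoeff r z • enneperNormal z from rfl, fderiv_fun_smul h1 h2]
  simp

theorem isNormalVariation_enneperVariation {r : ℝ} (hr : 0 < r) :
    IsNormalVariation (Metric.closedBall (0 : ℂ) r) enneper (enneperVariation r) where
  smooth := contDiff_enneperVariation hr
  normal z _ v := by
    rw [enneperVariation, inner_smul_left, fderiv_enneper]
    simp only [enneperNormal, PiLp.inner_apply, Fin.sum_univ_three]
    simp
    right
    ring
  boundary z hz := by
    rw [frontier_closedBall _ hr.ne', mem_sphere_zero_iff_norm] at hz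
    have h : z.re ^ 2 + z.im ^ 2 = r ^ 2 := by
      rw [← hz, Complex.sq_norm, Complex.normSq_apply]; ring
    simp [enneperVariation, variationCoeff, h]

theorem hasSecondVariation_enneperVariation {r : ℝ} (hr : 0 < r) :
    HasSecondVariation (Metric.closedBall (0 : ℂ) r) enneper (enneperVariation r)
      (∫ z in Metric.closedBall (0 : ℂ) r, (16 * r ^ 4 * ‖z‖ ^ 2 / (r ^ 2 + ‖z‖ ^ 2) ^ 4
        - 8 * ((r ^ 2 - ‖z‖ ^ 2) / ((r ^ 2 + ‖z‖ ^ 2) * (1 + ‖z‖ ^ 2))) ^ 2)) := by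
  refine hasSecondVariation_of_conformal (isCompact_closedBall 0 r) contDiff_enneper
    (contDiff_enneperVariation hr) (l := fun z => (1 + (z.re ^ 2 + z.im ^ 2)) ^ 2 / 4)
    -- `m` equals `u`: in these coordinates the second fundamental form along `ν` is `diag(-1, 1)`,
    -- and `⟨h_x, X_x⟩ = -⟨h_xx, X⟩`.
    (m := fun z => variationCoeff r z * (1 + (z.re ^ 2 + z.im ^ 2)))
    (fun z => by positivity) ?_ ?_ ?_ ?_ ?_ ?_ ?_ ?_ <;> intro z
  · rw [fderiv_enneper, EuclideanSpace.real_norm_sq_eq, Fin.sum_univ_three]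
    simp
    ring
  · rw [fderiv_enneper, EuclideanSpace.real_norm_sq_eq, Fin.sum_univ_three]
    simp
    ring
  · simp only [fderiv_enneper, PiLp.inner_apply, Fin.sum_univ_three]
    simp
    ring
  · simp only [fderiv_enneper, fderiv_enneperVariation hr, fderiv_enneperNormal, enneperNormal,
      PiLp.inner_apply, Fin.sum_univ_three]
    simp
    ring
  · simp only [fderiv_enneper, fderiv_enneperVariation hr, fderiv_enneperNormal, enneperNormal,
      PiLp.inner_apply, Fin.sum_univ_three]
    simp
    ring
  · simp only [fderiv_enneper, fderiv_enneperVariation hr, fderiv_enneperNormal, enneperNormal,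
      PiLp.inner_apply, Fin.sum_univ_three]
    simp
    ring
  · simp only [fderiv_enneper, fderiv_enneperVariation hr, fderiv_enneperNormal, enneperNormal,
      PiLp.inner_apply, Fin.sum_univ_three]
    simp
    ring
  · have hz : ‖z‖ ^ 2 = z.re ^ 2 + z.im ^ 2 := by
      rw [Complex.sq_norm, Complex.normSq_apply]; ring
    rw [hz, EuclideanSpace.real_norm_sq_eq, EuclideanSpace.real_norm_sq_eq]
    simp only [fderiv_enneperVariation hr, fderiv_enneperNormal, enneperNormal,
      Fin.sum_univ_three]
    have p1 : r ^ 2 + (z.re ^ 2 + z.im ^ 2) ≠ 0 := by positivity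
    have p2 : 1 + (z.re ^ 2 + z.im ^ 2) ≠ 0 := by positivity
    simp [variationCoeff, variationCoeffDeriv]
    field_simp
    ring

end MinimalSurface

end

theorem corollaryD (r : ℝ) (hr : 1 < r) :
    MinimalSurface.IsUnstable (Metric.closedBall (0 : ℂ) r) MinimalSurface.enneper := by
  have hr0 : 0 < r := one_pos.trans hr
  refine ⟨_, MinimalSurface.isNormalVariation_enneperVariation hr0, _,
    MinimalSurface.hasSecondVariation_enneperVariation hr0, ?_⟩
  rw [MinimalSurface.setIntegral_closedBall_radial hr0.le fun x =>
    16 * r ^ 4 * x ^ 2 / (r ^ 2 + x ^ 2) ^ 4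
      - 8 * ((r ^ 2 - x ^ 2) / ((r ^ 2 + x ^ 2) * (1 + x ^ 2))) ^ 2]
  exact mul_neg_of_pos_of_neg (by positivity)
    (MinimalSurface.intervalIntegral_radial_index_neg hr)
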